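/- **Setting.** Let $x_1,\dots,x_K\in\mathbb{R}^d$ be the feature vectors of $K$ arms, spanning $\mathbb{R}^d$, let $\rho\in\mathbb{R}$ be a threshold and $\delta\in(0,1)$. In the linear bandit environment with unknown parameter $\theta\in\mathbb{R}^d$, pulling arm $a$ yields a reward $x_a^\top\theta+\eta$, where $\eta\sim N(0,\sigma^2)$ is independent of the past. A strategy $(\pi,\tau,\phi)$ consists of a (possibly randomized) sampling rule $\pi$, which chooses each arm from the past arms and rewards; a stopping time $\tau\in\{0,1,2,\dots\}\cup\{\infty\}$, the number of observations collected, with respect to the filtration $(\mathcal F_n)$ in which $\mathcal F_n$ is generated by the first $n$ observations; and an $\mathcal F_\tau$-measurable set of arms $\phi$. Let $\mathbb{P}_\theta$, $\mathbb{E}_\theta$ be the resulting law and expectation. Put $\Pi_\rho(\theta)=\{a: x_a^\top\theta>\rho\}$ and $\Delta(x_a)=|x_a^\top\theta-\rho|$. The strategy is $\delta$-correct if $$\mathbb{P}_{\theta'}[\Pi_\rho(\theta')=\phi]\ge 1-\delta\quad\text{and}\quad \mathbb{P}_{\theta'}[\tau<\infty]=1$$ for every $\theta'\in\mathbb{R}^d$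 such that $x_a^\top\theta'\ne\rho$ for all arms $a$ with $x_a\neq 0$. **Claim.** For every $\theta\in\mathbb{R}^d$ and every $\delta$-correct strategy, $$\mathbb{E}_\theta[\tau]\;\ge\;\sigma^2\,\log\!\Big(\frac{1}{2\delta}\Big)\,T^\star_\theta,\qquad T^\star_\theta=\min_{\lambda}\ \max_{a}\ \frac{2\,\|x_a\|^2_{A_\lambda^{-1}}}{\Delta(x_a)^2},$$ where $A_\lambda=\sum_{a}\lambda_a x_a x_a^\top$, $\|v\|^2_{A_\lambda^{-1}}=v^\top A_\lambda^{-1}v$, and $\lambda$ ranges over the probability vectors in $[0,1]^K$ for which $A_\lambda$ is invertible. (Values are taken in $[0,\infty]$, with $c/0=\infty$ for $c>0$ and $0/0=0$; for $\delta\ge 1/2$ the right-hand side is not positive and the claim is trivial.) -/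

import Mathlib

open MeasureTheory ProbabilityTheory
open scoped NNReal ENNReal Matrix

noncomputable section

namespace LinearTBP

/-- The outcome of one round: the arm that was pulled and the reward that was observed. -/
abbrev Obs (K : ℕ) : Type := Fin K × ℝ

/-- A full interaction sequence. Coordinate `n` is the outcome of the round after `n` observations
(so coordinate `0` is the first round). -/
abbrev Traj (K : ℕ) : Type := ℕ → Obs K

/-- The restriction of a trajectory to its first `n` observations. -/
def history {K : ℕ} (n : ℕ) (ω : Traj K) : Fin n → Obs K := fun i => ω i

/-- The filtration whose `n`-th σ-algebra is generated by the first `n` observations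
(trivial for `n = 0`). -/
def obsFiltration (K : ℕ) :
    Filtration ℕ (inferInstance : MeasurableSpace (Traj K)) where
  seq n := MeasurableSpace.comap (history n) inferInstance
  mono' := by
    intro m n hmn
    rintro s ⟨t, ht, rfl⟩
    refine ⟨(fun h : Fin n → Obs K => fun i : Fin m => h (Fin.castLE hmn i)) ⁻¹' t, ?_, rfl⟩
    exact ht.preimage (measurable_pi_lambda _ fun i => measurable_pi_apply _)
  le' n := Measurable.comap_le (measurable_pi_lambda _ fun i => measurable_pi_apply _)

/-- A strategy `(π, τ, φ)`: a randomized sampling rule `π`, a stopping rule `τ` (the number of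
observations collected before stopping, possibly infinite) and a decision rule `φ`.
No component has access to the unknown parameter. -/
structure Strategy (K : ℕ) where
  /-- The distribution of the first arm. -/
  init : Measure (Fin K)
  /-- The distribution of the arm pulled after the observations `0, …, n`. -/
  sample : ∀ n : ℕ, Kernel (∀ _ : Finset.Iic n, Obs K) (Fin K)
  /-- The stopping rule. -/
  τ : Traj K → WithTop ℕ
  /-- The decision rule: the set of arms that is returned. -/
  φ : Traj K → Set (Fin K)
  isProbabilityMeasure_init : IsProbabilityMeasure init
  isMarkovKernel_sample : ∀ n, IsMarkovKernel (sample n)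
  isStoppingTime_τ : IsStoppingTime (obsFiltration K) τ
  /-- `φ` is measurable with respect to the σ-algebra of the stopping time `τ`. -/
  measurable_φ : ∀ S : Set (Fin K), MeasurableSet[isStoppingTime_τ.measurableSpace] {ω | φ ω = S}

attribute [instance] Strategy.isProbabilityMeasure_init Strategy.isMarkovKernel_sample

variable {K d : ℕ}

/-- The law of the reward `x_aᵀ θ + η`, `η ∼ N(0, σ²)`, given the pulled arm `a`. -/
def rewardKernel (x : Fin K → Fin d → ℝ) (σ : ℝ≥0) (θ : Fin d → ℝ) : Kernel (Fin K) ℝ where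
  toFun a := gaussianReal (x a ⬝ᵥ θ) (σ ^ 2)
  measurable' := measurable_of_countable _

instance (x : Fin K → Fin d → ℝ) (σ : ℝ≥0) (θ : Fin d → ℝ) :
    IsMarkovKernel (rewardKernel x σ θ) :=
  ⟨fun a => inferInstanceAs (IsProbabilityMeasure (gaussianReal (x a ⬝ᵥ θ) (σ ^ 2)))⟩

/-- The conditional law of the next outcome given the past: the arm is drawn from the sampling rule
and then, given the arm, the reward is drawn independently of the past. -/
def Strategy.step (s : Strategy K) (x : Fin K → Fin d → ℝ) (σ : ℝ≥0) (θ : Fin d → ℝ) (n : ℕ) :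
    Kernel (∀ _ : Finset.Iic n, Obs K) (Obs K) :=
  s.sample n ⊗ₖ Kernel.prodMkLeft (∀ _ : Finset.Iic n, Obs K) (rewardKernel x σ θ)

instance (s : Strategy K) (x : Fin K → Fin d → ℝ) (σ : ℝ≥0) (θ : Fin d → ℝ) (n : ℕ) :
    IsMarkovKernel (s.step x σ θ n) := by
  unfold Strategy.step; infer_instance

/-- The law `ℙ_θ` of the interaction sequence when the strategy `s` samples in the environment with
arms `x`, noise variance `σ²` and parameter `θ`. -/
def Strategy.law (s : Strategy K) (x : Fin K → Fin d → ℝ) (σ : ℝ≥0) (θ : Fin d → ℝ) :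
    Measure (Traj K) :=
  Kernel.trajMeasure (X := fun _ : ℕ => Obs K) (s.init ⊗ₘ rewardKernel x σ θ) (s.step x σ θ)

/-- `Π_ρ(θ)`: the arms with mean reward above the threshold `ρ`. -/
def goodArms (x : Fin K → Fin d → ℝ) (ρ : ℝ) (θ : Fin d → ℝ) : Set (Fin K) :=
  {a | ρ < x a ⬝ᵥ θ}

/-- The gap `Δ(x_a) = |x_aᵀ θ - ρ|`. -/
def gap (x : Fin K → Fin d → ℝ) (ρ : ℝ) (θ : Fin d → ℝ) (a : Fin K) : ℝ :=
  |x a ⬝ᵥ θ - ρ|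

/-- No arm (with a nonzero feature vector) has its mean reward exactly at the threshold. -/
def Nondegenerate (x : Fin K → Fin d → ℝ) (ρ : ℝ) (θ : Fin d → ℝ) : Prop :=
  ∀ a, x a ≠ 0 → gap x ρ θ a ≠ 0

/-- `δ`-correctness: in every environment without an arm exactly at the threshold, the strategy
stops almost surely and returns `Π_ρ(θ)` with probability at least `1 - δ`. (For `δ < 1 / 2` no
strategy can do so for every `θ`, those with an arm exactly at the threshold included.) -/
def Strategy.IsCorrect (s : Strategy K) (x : Fin K → Fin d → ℝ) (σ : ℝ≥0) (ρ δ : ℝ) : Prop :=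
  ∀ θ : Fin d → ℝ, Nondegenerate x ρ θ →
    ENNReal.ofReal (1 - δ) ≤ s.law x σ θ {ω | goodArms x ρ θ = s.φ ω} ∧
      s.law x σ θ {ω | s.τ ω < ⊤} = 1

/-- The expected number of observations `𝔼_θ[τ]`, a value in `[0, ∞]`. -/
def Strategy.expectedTime (s : Strategy K) (x : Fin K → Fin d → ℝ) (σ : ℝ≥0) (θ : Fin d → ℝ) :
    ℝ≥0∞ :=
  ∫⁻ ω, ENat.toENNReal (s.τ ω) ∂(s.law x σ θ)

/-- The design matrix `A_l = ∑ a, l_a x_a x_aᵀ`. -/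
def designMatrix (x : Fin K → Fin d → ℝ) (l : Fin K → ℝ) : Matrix (Fin d) (Fin d) ℝ :=
  ∑ a, l a • Matrix.vecMulVec (x a) (x a)

/-- The complexity `T*_θ = min_l max_a 2 ‖x_a‖²_{A_l⁻¹} / Δ(x_a)²`, a value in `[0, ∞]`, where `l`
ranges over the probability vectors with an invertible (i.e. positive definite) design matrix.
The quotient is that of `[0, ∞]`: `c / 0 = ∞` for `c > 0`, and `0 / 0 = 0`. -/
def complexity (x : Fin K → Fin d → ℝ) (ρ : ℝ) (θ : Fin d → ℝ) : ℝ≥0∞ :=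
  ⨅ l ∈ {l : Fin K → ℝ | l ∈ stdSimplex ℝ (Fin K) ∧ (designMatrix x l).PosDef},
    ⨆ a : Fin K, ENNReal.ofReal (2 * (x a ⬝ᵥ ((designMatrix x l)⁻¹ *ᵥ x a))) /
      ENNReal.ofReal (gap x ρ θ a ^ 2)

end LinearTBP

end

/-!
The bound follows from a comparison of `θ` with the parameters `θ'` for which some arm `a` with
`x_a ≠ 0` lies exactly at the threshold. Such a `θ'` is the limit of nondegenerate parameters from
both sides of the threshold, and these have different sets of good arms. An event that concerns
finitely many rounds has a lower semicontinuous probability (Fatou's lemma for the likelihood ratio,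
`law_le_of_tendsto`), so under `θ'` each of the events "stop and do not return the first set" and
"stop and do not return the second set" has probability at most `δ`. No decision avoids both events,
so a correct strategy stops under `θ'` with probability at most `2δ` (`law_tau_le_of_at_threshold`).

If `𝔼_θ[τ]` is finite, then the strategy stops almost surely under `θ`. To tell `θ` from `θ'` in
this way it has to collect information `log (1 / (2δ))` (`neg_log_le_sum_expectedPulls`):
`∑ a, w_a (x_aᵀ (θ' - θ))² / (2σ²) ≥ log (1 / (2δ))`, where `w_a` is the expected number of pulls of
`a` before stopping. For this, the log-likelihood ratio `Z_n` of `θ'` against `θ` stopped at `τ ∧ n`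
is integrated under `θ`. Its integral is computed round by round, the conditional law of the reward
being Gaussian; on the other hand `z ≤ exp (z - c) + c - 1`, with `c = log (2δ)` on `{τ ≤ n}` and a
large `c` on `{n < τ}`, bounds it in terms of the integrals of `exp Z_n`, which a change of measure
turns into probabilities under `θ'`. The event `{n < τ}` disappears as `n → ∞`.

Since `∑ a, w_a = 𝔼_θ[τ]`, the proportions `w / 𝔼_θ[τ]` are a design. Taking for `θ' - θ` a multiple
of a given direction shows that the design matrix `A` is positive definite, and the direction
`A⁻¹ x_a` gives the required bound on `2 ‖x_a‖² / Δ(x_a)²` (`ofReal_mul_complexity_le`). The case of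
a parameter `θ` with an arm at the threshold is included: there the expected stopping time is
infinite, because `θ' = θ` would have to provide positive information.
-/

namespace LinearTBP

variable {K d : ℕ}

/-! ### The law of one round given the past -/

instance (s : Strategy K) (x : Fin K → Fin d → ℝ) (σ : ℝ≥0) (θ : Fin d → ℝ) :
    IsProbabilityMeasure (s.law x σ θ) := by
  unfold Strategy.law; infer_instance

/-- The distribution of the arm pulled after `n` observations, as a kernel from trajectories. -/
noncomputable def Strategy.arm (s : Strategy K) : ℕ → Kernel (Traj K) (Fin K)
  | 0 => Kernel.const _ s.init
  | n + 1 => (s.sample n).comap (Preorder.frestrictLe (π := fun _ : ℕ => Obs K) n) (by fun_prop)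

instance (s : Strategy K) (n : ℕ) : IsMarkovKernel (s.arm n) := by
  cases n <;> (unfold Strategy.arm; infer_instance)

/-- Pulling an arm in round `n` uses only the rounds before it. -/
lemma Strategy.arm_congr (s : Strategy K) {n : ℕ} {ω ω' : Traj K} (h : ∀ i < n, ω i = ω' i) :
    s.arm n ω = s.arm n ω' := by
  cases n with
  | zero => rfl
  | succ n =>
    simp only [Strategy.arm, Kernel.comap_apply]
    congr 1
    ext1 i
    exact h _ (Nat.lt_succ_of_le (Finset.mem_Iic.1 i.2))

lemma Strategy.map_eval_zero_law (s : Strategy K) (x : Fin K → Fin d → ℝ) (σ : ℝ≥0)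
    (θ : Fin d → ℝ) :
    (s.law x σ θ).map (fun ω => ω 0) = s.init ⊗ₘ rewardKernel x σ θ := by
  have h1 : (s.law x σ θ).map (Preorder.frestrictLe (π := fun _ : ℕ => Obs K) 0) =
      (s.init ⊗ₘ rewardKernel x σ θ).map
        (MeasurableEquiv.piUnique (fun _ : Finset.Iic 0 => Obs K)).symm := by
    rw [Strategy.law, Kernel.trajMeasure, Measure.map_comp _ _ (by fun_prop),
      Kernel.traj_map_frestrictLe, Kernel.partialTraj_self, Measure.id_comp]
  have h2 : (fun ω : Traj K => ω 0) =
      (fun h : ∀ _ : Finset.Iic 0, Obs K => h ⟨0, by simp⟩) ∘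
        Preorder.frestrictLe (π := fun _ : ℕ => Obs K) 0 := rfl
  rw [h2, ← Measure.map_map (by fun_prop) (by fun_prop), h1, Measure.map_map (by fun_prop)
    (by fun_prop)]
  exact Measure.map_id

/-- The trajectory with history `h` in the rounds up to `n` and `o` in all later rounds. -/
def glue (n : ℕ) (p : (∀ _ : Finset.Iic n, Obs K) × Obs K) : Traj K :=
  fun i => if hi : i ∈ Finset.Iic n then p.1 ⟨i, hi⟩ else p.2

lemma measurable_glue (n : ℕ) : Measurable (glue (K := K) n) := by
  refine measurable_pi_lambda _ fun i => ?_
  unfold glue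
  split_ifs <;> fun_prop

/-- One-step disintegration of the law: in round `n` the arm is drawn from `s.arm n` and the reward
from the reward kernel. -/
lemma Strategy.lintegral_law (s : Strategy K) (x : Fin K → Fin d → ℝ) (σ : ℝ≥0) (θ : Fin d → ℝ)
    (n : ℕ) {G : Traj K → ℝ≥0∞} (hG : Measurable G) (hd : DependsOn G (Set.Iio (n + 1))) :
    ∫⁻ ω, G ω ∂s.law x σ θ =
      ∫⁻ ω, ∫⁻ a, ∫⁻ r, G (Function.update ω n (a, r)) ∂rewardKernel x σ θ a ∂s.arm n ω
        ∂s.law x σ θ := by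
  cases n with
  | zero =>
    have h1 : ∀ ω : Traj K, G ω = (fun o => G (fun _ => o)) (ω 0) := fun ω =>
      hd fun i hi => by obtain rfl : i = 0 := by simpa using hi
                        rfl
    have hF : Measurable fun o : Obs K => G (fun _ => o) :=
      hG.comp (measurable_pi_lambda _ fun _ => measurable_id)
    have h2 : ∀ (ω : Traj K) (o : Obs K), G (Function.update ω 0 o) = G (fun _ => o) := fun ω o =>
      hd fun i hi => by obtain rfl : i = 0 := by simpa using hi
                        simp
    simp_rw [h2]
    simp only [Strategy.arm, Kernel.const_apply, lintegral_const, measure_univ, mul_one]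
    rw [lintegral_congr h1, ← lintegral_map hF (measurable_pi_apply 0), s.map_eval_zero_law,
      Measure.lintegral_compProd hF]
  | succ n =>
    have h1 : ∀ ω : Traj K,
        G ω = (fun p => G (glue n p)) (Preorder.frestrictLe (π := fun _ : ℕ => Obs K) n ω,
          ω (n + 1)) := fun ω =>
      hd fun i hi => by
        simp only [glue, Finset.mem_Iic]
        split_ifs with h
        · rfl
        · rw [show i = n + 1 by have := Set.mem_Iio.1 hi; omega]
    have h2 : ∀ (ω : Traj K) (o : Obs K), G (Function.update ω (n + 1) o) =
        G (glue n (Preorder.frestrictLe (π := fun _ : ℕ => Obs K) n ω, o)) := fun ω o =>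
      hd fun i hi => by
        simp only [glue, Finset.mem_Iic]
        split_ifs with h
        · rw [Function.update_of_ne (by omega)]; rfl
        · rw [show i = n + 1 by have := Set.mem_Iio.1 hi; omega]; simp
    have hF : Measurable fun p : (∀ _ : Finset.Iic n, Obs K) × Obs K => G (glue n p) :=
      hG.comp (measurable_glue n)
    simp_rw [h2]
    rw [lintegral_congr h1, ← lintegral_map hF (by fun_prop)]
    rw [Strategy.law, ← Kernel.map_frestrictLe_trajMeasure_compProd_eq_map_trajMeasure,
      Measure.lintegral_compProd hF, lintegral_map (hF.lintegral_kernel_prod_right')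
        (by fun_prop)]
    refine lintegral_congr fun ω => ?_
    have hω : Measurable fun o : Obs K =>
        G (glue n (Preorder.frestrictLe (π := fun _ : ℕ => Obs K) n ω, o)) :=
      hF.comp measurable_prodMk_left
    rw [Strategy.step, Kernel.lintegral_compProd _ _ _ hω]
    simp only [Strategy.arm, Kernel.comap_apply, Kernel.prodMkLeft_apply]

/-! ### Change of measure -/

lemma lintegral_gaussianReal_eq (m m' : ℝ) {v : ℝ≥0} (hv : v ≠ 0) {f : ℝ → ℝ≥0∞}
    (hf : Measurable f) :
    ∫⁻ r, f r ∂gaussianReal m' v =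
      ∫⁻ r, f r * ENNReal.ofReal (Real.exp ((m' - m) * (2 * r - m - m') / (2 * v)))
        ∂gaussianReal m v := by
  rw [gaussianReal_of_var_ne_zero _ hv, gaussianReal_of_var_ne_zero _ hv,
    lintegral_withDensity_eq_lintegral_mul _ (measurable_gaussianPDF _ _) hf,
    lintegral_withDensity_eq_lintegral_mul _ (measurable_gaussianPDF _ _) (by fun_prop)]
  refine lintegral_congr fun r => ?_
  have hv' : (v : ℝ) ≠ 0 := by exact_mod_cast hv
  have key : gaussianPDFReal m' v r =
      gaussianPDFReal m v r * Real.exp ((m' - m) * (2 * r - m - m') / (2 * v)) := by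
    rw [gaussianPDFReal, gaussianPDFReal, mul_assoc _ (Real.exp _), ← Real.exp_add]
    congr 2
    field_simp
    ring
  simp only [Pi.mul_apply, gaussianPDF, key]
  rw [ENNReal.ofReal_mul (gaussianPDFReal_nonneg _ _ _)]
  ring

/-- The log-likelihood ratio of `θ'` against `θ` of a single observation. It is meaningful for
`σ ≠ 0` only. -/
noncomputable def llr (x : Fin K → Fin d → ℝ) (σ : ℝ≥0) (θ θ' : Fin d → ℝ) (o : Obs K) : ℝ :=
  (x o.1 ⬝ᵥ θ' - x o.1 ⬝ᵥ θ) * (2 * o.2 - x o.1 ⬝ᵥ θ - x o.1 ⬝ᵥ θ') / (2 * σ ^ 2)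

lemma measurable_llr (x : Fin K → Fin d → ℝ) (σ : ℝ≥0) (θ θ' : Fin d → ℝ) :
    Measurable (llr x σ θ θ') := by
  refine measurable_from_prod_countable_right fun a => ?_
  unfold llr
  fun_prop

lemma lintegral_rewardKernel_eq (x : Fin K → Fin d → ℝ) {σ : ℝ≥0} (hσ : σ ≠ 0)
    (θ θ' : Fin d → ℝ) (a : Fin K) {f : ℝ → ℝ≥0∞} (hf : Measurable f) :
    ∫⁻ r, f r ∂rewardKernel x σ θ' a =
      ∫⁻ r, f r * ENNReal.ofReal (Real.exp (llr x σ θ θ' (a, r))) ∂rewardKernel x σ θ a := by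
  have := lintegral_gaussianReal_eq (x a ⬝ᵥ θ) (x a ⬝ᵥ θ') (pow_ne_zero 2 hσ) hf
  simpa [llr, rewardKernel] using this

/-- The likelihood ratio of `θ'` against `θ` of the first `n` observations. -/
noncomputable def lik (x : Fin K → Fin d → ℝ) (σ : ℝ≥0) (θ θ' : Fin d → ℝ) (n : ℕ) (ω : Traj K) :
    ℝ≥0∞ :=
  ENNReal.ofReal (Real.exp (∑ i ∈ Finset.range n, llr x σ θ θ' (ω i)))

lemma measurable_lik (x : Fin K → Fin d → ℝ) (σ : ℝ≥0) (θ θ' : Fin d → ℝ) (n : ℕ) :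
    Measurable (lik x σ θ θ' n) := by
  have := measurable_llr x σ θ θ'
  unfold lik
  fun_prop

lemma dependsOn_lik (x : Fin K → Fin d → ℝ) (σ : ℝ≥0) (θ θ' : Fin d → ℝ) (n : ℕ) :
    DependsOn (lik x σ θ θ' n) (Set.Iio n) := by
  intro ω ω' h
  unfold lik
  rw [Finset.sum_congr rfl fun i hi => by rw [h i (Finset.mem_range.1 hi)]]

lemma lik_succ_update (x : Fin K → Fin d → ℝ) (σ : ℝ≥0) (θ θ' : Fin d → ℝ) (n : ℕ) (ω : Traj K)
    (o : Obs K) :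
    lik x σ θ θ' (n + 1) (Function.update ω n o) =
      lik x σ θ θ' n ω * ENNReal.ofReal (Real.exp (llr x σ θ θ' o)) := by
  have h : lik x σ θ θ' n (Function.update ω n o) = lik x σ θ θ' n ω :=
    dependsOn_lik x σ θ θ' n fun i hi => Function.update_of_ne (Set.mem_Iio.1 hi).ne _ _
  rw [← h]
  unfold lik
  rw [Finset.sum_range_succ, Real.exp_add, ENNReal.ofReal_mul (Real.exp_pos _).le]
  simp

lemma dependsOn_update_succ {β : Type*} {G : Traj K → β} {n : ℕ}
    (hd : DependsOn G (Set.Iio (n + 1))) {ω ω' : Traj K} (h : ∀ i < n, ω i = ω' i) (o : Obs K) :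
    G (Function.update ω n o) = G (Function.update ω' n o) :=
  hd fun i hi => by
    rcases (Nat.lt_succ_iff_lt_or_eq.1 (Set.mem_Iio.1 hi)) with hi | rfl
    · rw [Function.update_of_ne hi.ne, Function.update_of_ne hi.ne, h i hi]
    · simp

lemma measurable_lintegral_update (s : Strategy K) (x : Fin K → Fin d → ℝ) (σ : ℝ≥0)
    (θ : Fin d → ℝ) (n : ℕ) {G : Traj K → ℝ≥0∞} (hG : Measurable G) :
    Measurable fun ω => ∫⁻ a, ∫⁻ r, G (Function.update ω n (a, r)) ∂rewardKernel x σ θ a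
      ∂s.arm n ω := by
  have h : Measurable fun p : (Traj K × Fin K) × ℝ => Function.update p.1.1 n (p.1.2, p.2) := by
    refine measurable_pi_lambda _ fun i => ?_
    by_cases hi : i = n
    · subst hi; simp only [Function.update_self]; fun_prop
    · simp only [Function.update_of_ne hi]; fun_prop
  have h2 : Measurable fun p : Traj K × Fin K =>
      ∫⁻ r, G (Function.update p.1 n (p.2, r))
        ∂(Kernel.prodMkLeft (Traj K) (rewardKernel x σ θ)) p :=
    Measurable.lintegral_kernel_prod_right' (hG.comp h)
  exact Measurable.lintegral_kernel_prod_right' h2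

/-- Change of measure on the first `n` observations. The sampling rule cancels, because it does not
depend on the parameter. -/
lemma lintegral_law_eq_mul_lik (s : Strategy K) (x : Fin K → Fin d → ℝ) {σ : ℝ≥0} (hσ : σ ≠ 0)
    (θ θ' : Fin d → ℝ) (n : ℕ) {G : Traj K → ℝ≥0∞} (hG : Measurable G)
    (hd : DependsOn G (Set.Iio n)) :
    ∫⁻ ω, G ω ∂s.law x σ θ' = ∫⁻ ω, G ω * lik x σ θ θ' n ω ∂s.law x σ θ := by
  induction n generalizing G with
  | zero =>
    obtain ⟨c, hc⟩ : ∃ c, ∀ ω, G ω = c := by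
      rcases isEmpty_or_nonempty (Traj K) with h | ⟨⟨ω⟩⟩
      · exact ⟨0, fun ω => isEmptyElim ω⟩
      · exact ⟨G ω, fun ω' => hd fun i hi => absurd hi (by simp)⟩
    simp [hc, lik]
  | succ n ih =>
    rw [s.lintegral_law x σ θ' n hG hd,
      ih (measurable_lintegral_update s x σ θ' n hG) ?_,
      s.lintegral_law x σ θ n (G := fun ω => G ω * lik x σ θ θ' (n + 1) ω)
        (hG.mul (measurable_lik x σ θ θ' (n + 1)))
        fun ω ω' h => congrArg₂ (· * ·) (hd h) (dependsOn_lik x σ θ θ' (n + 1) h)]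
    · refine lintegral_congr fun ω => ?_
      rw [← lintegral_mul_const _ (measurable_of_countable _)]
      refine lintegral_congr fun a => ?_
      have hm : Measurable fun r : ℝ => G (Function.update ω n (a, r)) := by
        have : Measurable fun r : ℝ => Function.update ω n (a, r) :=
          (measurable_update ω).comp measurable_prodMk_left
        exact hG.comp this
      have hl := measurable_llr x σ θ θ'
      rw [lintegral_rewardKernel_eq x hσ θ θ' a hm, ← lintegral_mul_const _ (by fun_prop)]
      refine lintegral_congr fun r => ?_
      rw [lik_succ_update]
      ring
    · intro ω ω' h
      simp only [s.arm_congr h, dependsOn_update_succ hd h]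

/-! ### Parameters with an arm at the threshold -/

lemma mem_iff_of_measurableSet_obsFiltration {n : ℕ} {B : Set (Traj K)}
    (hB : MeasurableSet[obsFiltration K n] B) {ω ω' : Traj K} (h : ∀ i < n, ω i = ω' i) :
    ω ∈ B ↔ ω' ∈ B := by
  obtain ⟨t, -, rfl⟩ := hB
  have : history n ω = history n ω' := funext fun i => h i i.2
  simp [this]

lemma law_eq_lintegral_lik (s : Strategy K) (x : Fin K → Fin d → ℝ) {σ : ℝ≥0} (hσ : σ ≠ 0)
    (θ θ' : Fin d → ℝ) {n : ℕ} {B : Set (Traj K)} (hB : MeasurableSet[obsFiltration K n] B) :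
    s.law x σ θ' B = ∫⁻ ω in B, lik x σ θ θ' n ω ∂s.law x σ θ := by
  have hB' : MeasurableSet B := (obsFiltration K).le n _ hB
  rw [← lintegral_indicator_one hB', lintegral_law_eq_mul_lik s x hσ θ θ' n
    (measurable_one.indicator hB'), ← lintegral_indicator hB']
  · refine lintegral_congr fun ω => ?_
    by_cases hω : ω ∈ B <;> simp [hω]
  · intro ω ω' h
    have := mem_iff_of_measurableSet_obsFiltration hB h
    by_cases hω : ω ∈ B
    · simp [hω, this.1 hω]
    · simp [hω, mt this.2 hω]

/-- The probability of an event of finitely many rounds is lower semicontinuous in the parameter. -/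
lemma law_le_of_tendsto (s : Strategy K) (x : Fin K → Fin d → ℝ) {σ : ℝ≥0} (hσ : σ ≠ 0)
    {θ : Fin d → ℝ} {u : ℕ → Fin d → ℝ} (hu : Filter.Tendsto u Filter.atTop (nhds θ))
    {n : ℕ} {B : Set (Traj K)} (hB : MeasurableSet[obsFiltration K n] B) {c : ℝ≥0∞}
    (hc : ∀ᶠ j in Filter.atTop, s.law x σ (u j) B ≤ c) : s.law x σ θ B ≤ c := by
  have hlim : ∀ ω, Filter.Tendsto (fun j => lik x σ θ (u j) n ω) Filter.atTop (nhds 1) := by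
    intro ω
    have hcont : Continuous fun θ' => lik x σ θ θ' n ω := by
      unfold lik llr
      refine ENNReal.continuous_ofReal.comp (Real.continuous_exp.comp ?_)
      refine continuous_finsetSum _ fun i _ => ?_
      have : Continuous fun θ' : Fin d → ℝ => x (ω i).1 ⬝ᵥ θ' := by
        unfold dotProduct; fun_prop
      fun_prop
    have := (hcont.tendsto θ).comp hu
    simpa [lik, llr, Function.comp_def] using this
  calc s.law x σ θ B = ∫⁻ ω in B, 1 ∂s.law x σ θ := by simp
    _ = ∫⁻ ω in B, Filter.liminf (fun j => lik x σ θ (u j) n ω) Filter.atTop ∂s.law x σ θ :=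
      lintegral_congr fun ω => (hlim ω).liminf_eq.symm
    _ ≤ Filter.liminf (fun j => ∫⁻ ω in B, lik x σ θ (u j) n ω ∂s.law x σ θ) Filter.atTop :=
      lintegral_liminf_le fun j => measurable_lik x σ θ (u j) n
    _ = Filter.liminf (fun j => s.law x σ (u j) B) Filter.atTop := by
      simp_rw [← law_eq_lintegral_lik s x hσ θ _ hB]
    _ ≤ c := Filter.liminf_le_of_frequently_le' hc.frequently

lemma Strategy.IsCorrect.law_ne_le {s : Strategy K} {x : Fin K → Fin d → ℝ} {σ : ℝ≥0} {ρ δ : ℝ}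
    (hs : s.IsCorrect x σ ρ δ) (hδ : δ ∈ Set.Ioo (0 : ℝ) 1) {θ : Fin d → ℝ}
    (hθ : Nondegenerate x ρ θ) : s.law x σ θ {ω | s.φ ω ≠ goodArms x ρ θ} ≤ ENNReal.ofReal δ := by
  have hm : MeasurableSet {ω | s.φ ω = goodArms x ρ θ} :=
    s.isStoppingTime_τ.measurableSpace_le _ (s.measurable_φ _)
  have h1 := (hs θ hθ).1
  simp only [eq_comm (a := goodArms x ρ θ)] at h1
  have h2 : {ω | s.φ ω ≠ goodArms x ρ θ} = {ω | s.φ ω = goodArms x ρ θ}ᶜ := rfl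
  rw [h2, prob_compl_eq_one_sub hm]
  calc 1 - s.law x σ θ {ω | s.φ ω = goodArms x ρ θ} ≤ 1 - ENNReal.ofReal (1 - δ) := by gcongr
    _ = ENNReal.ofReal δ := by
      rw [← ENNReal.ofReal_one, ← ENNReal.ofReal_sub _ (by linarith [hδ.2])]
      congr 1; ring

lemma exists_forall_dotProduct_ne_zero (x : Fin K → Fin d → ℝ) :
    ∃ v : Fin d → ℝ, ∀ a, x a ≠ 0 → x a ⬝ᵥ v ≠ 0 := by
  obtain ⟨v, hv⟩ := Module.Dual.exists_forall_ne_zero_of_forall_exists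
    (K := ℝ) (M := Fin d → ℝ) (ι := {a // x a ≠ 0})
    (fun a => dotProductBilin ℝ ℝ (x a.1)) fun a =>
      ⟨x a.1, by simpa [dotProductBilin] using a.2⟩
  exact ⟨v, fun a ha => by simpa [dotProductBilin] using hv ⟨a, ha⟩⟩

open Filter Topology in
/-- Along a generic direction `v`, the points near `θ` have no arm at the threshold, and their set
of good arms consists of the arms above the threshold at `θ` and those that `v` lifts from it. -/
lemma eventually_goodArms_add_smul (x : Fin K → Fin d → ℝ) (ρ : ℝ) (θ : Fin d → ℝ)
    {v : Fin d → ℝ} (hv : ∀ a, x a ≠ 0 → x a ⬝ᵥ v ≠ 0) :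
    ∀ᶠ t : ℝ in 𝓝[>] 0, Nondegenerate x ρ (θ + t • v) ∧
      goodArms x ρ (θ + t • v) =
        {a | ρ < x a ⬝ᵥ θ ∨ (x a ⬝ᵥ θ = ρ ∧ 0 < x a ⬝ᵥ v)} := by
  have key : ∀ a, ∀ᶠ t : ℝ in 𝓝[>] 0,
      (x a ≠ 0 → x a ⬝ᵥ (θ + t • v) ≠ ρ) ∧
      (ρ < x a ⬝ᵥ (θ + t • v) ↔ ρ < x a ⬝ᵥ θ ∨ (x a ⬝ᵥ θ = ρ ∧ 0 < x a ⬝ᵥ v)) := by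
    intro a
    have hlim : Tendsto (fun t : ℝ => x a ⬝ᵥ (θ + t • v)) (𝓝[>] 0) (𝓝 (x a ⬝ᵥ θ)) := by
      have : Continuous fun t : ℝ => x a ⬝ᵥ (θ + t • v) := by
        simp only [dotProduct_add, dotProduct_smul]; fun_prop
      simpa using (this.tendsto 0).mono_left nhdsWithin_le_nhds
    rcases lt_trichotomy (x a ⬝ᵥ θ) ρ with h | h | h
    · filter_upwards [hlim.eventually_lt_const h] with t ht
      exact ⟨fun _ => ht.ne, ⟨fun h' => absurd h' ht.not_gt, fun h' => by
        rcases h' with h' | h'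
        · exact absurd h' h.not_gt
        · exact absurd h'.1 h.ne⟩⟩
    · filter_upwards [self_mem_nhdsWithin] with t ht
      have ht : 0 < t := ht
      rw [dotProduct_add, dotProduct_smul, h, smul_eq_mul]
      refine ⟨fun ha => by simpa using ⟨ht.ne', hv a ha⟩, ?_⟩
      simp [ht]
    · filter_upwards [hlim.eventually_const_lt h] with t ht
      exact ⟨fun _ => ht.ne', ⟨fun _ => Or.inl h, fun _ => ht⟩⟩
  filter_upwards [eventually_all.2 key] with t ht
  refine ⟨fun a ha => ?_, Set.ext fun a => (ht a).2⟩
  simpa [gap, sub_eq_zero] using (ht a).1 ha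

/-- When some arm is exactly at the threshold, a correct strategy stops with probability at most
`2δ`: on the two sides of the threshold it has to return different sets, and by semicontinuity it
fails to return either of them, after having stopped, with probability at most `δ`. -/
lemma law_tau_le_of_at_threshold {s : Strategy K} {x : Fin K → Fin d → ℝ} {σ : ℝ≥0} {ρ δ : ℝ}
    (hσ : σ ≠ 0) (hδ : δ ∈ Set.Ioo (0 : ℝ) 1) (hs : s.IsCorrect x σ ρ δ) {θ : Fin d → ℝ}
    {a : Fin K} (ha : x a ≠ 0) (hθ : x a ⬝ᵥ θ = ρ) (n : ℕ) :
    s.law x σ θ {ω | s.τ ω ≤ n} ≤ ENNReal.ofReal (2 * δ) := by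
  have main : ∀ v : Fin d → ℝ, (∀ a, x a ≠ 0 → x a ⬝ᵥ v ≠ 0) →
      s.law x σ θ ({ω | s.φ ω ≠ {a | ρ < x a ⬝ᵥ θ ∨ (x a ⬝ᵥ θ = ρ ∧ 0 < x a ⬝ᵥ v)}} ∩
        {ω | s.τ ω ≤ n}) ≤ ENNReal.ofReal δ := by
    intro v hv
    have h0 : Filter.Tendsto (fun j : ℕ => 1 / ((j : ℝ) + 1)) Filter.atTop (nhds 0) :=
      tendsto_one_div_add_atTop_nhds_zero_nat
    have h0' : Filter.Tendsto (fun j : ℕ => 1 / ((j : ℝ) + 1)) Filter.atTop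
        (nhdsWithin 0 (Set.Ioi 0)) :=
      tendsto_nhdsWithin_iff.2 ⟨h0, Filter.Eventually.of_forall fun j => by
        simp only [Set.mem_Ioi]; positivity⟩
    refine law_le_of_tendsto s x hσ (u := fun j : ℕ => θ + (1 / ((j : ℝ) + 1)) • v) ?_
      (n := n) ?_ ?_
    · simpa using (h0.smul_const v).const_add θ
    · have := (s.measurable_φ
        {a | ρ < x a ⬝ᵥ θ ∨ (x a ⬝ᵥ θ = ρ ∧ 0 < x a ⬝ᵥ v)}).compl
      exact ((s.isStoppingTime_τ.measurableSet _).1 this).2 n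
    · filter_upwards [h0'.eventually (eventually_goodArms_add_smul x ρ θ hv)] with j hj
      refine le_trans (measure_mono ?_) (hs.law_ne_le hδ hj.1)
      rw [hj.2]
      exact Set.inter_subset_left
  -- The sets reached along `v` and `-v` differ in the arm `a`.
  obtain ⟨v, hv⟩ := exists_forall_dotProduct_ne_zero x
  have hv' : ∀ a, x a ≠ 0 → x a ⬝ᵥ (-v) ≠ 0 := fun a ha => by simpa using hv a ha
  refine le_trans (le_trans (measure_mono ?_)
    ((measure_union_le _ _).trans (add_le_add (main v hv) (main (-v) hv')))) ?_
  · intro ω hω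
    by_contra hcon
    simp only [Set.mem_union, Set.mem_inter_iff, Set.mem_ofPred_eq, not_or, not_and_or,
      not_not] at hcon
    have hω' : ¬ ¬ s.τ ω ≤ n := not_not.2 hω
    have h1 := hcon.1.resolve_right hω'
    have h2 := hcon.2.resolve_right hω'
    have h3 := Set.ext_iff.1 (h1.symm.trans h2) a
    simp only [Set.mem_ofPred_eq, hθ, lt_irrefl, true_and, false_or, dotProduct_neg,
      Left.neg_pos_iff] at h3
    rcases lt_or_gt_of_ne (hv a ha) with h | h
    · exact absurd (h3.2 h) h.not_gt
    · exact absurd (h3.1 h) h.not_gt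
  · rw [← ENNReal.ofReal_add hδ.1.le hδ.1.le, two_mul]

/-! ### The information collected before stopping -/

/-- Given the past up to round `i` and the arm of that round, the reward has the law prescribed by
the reward kernel. -/
lemma map_restrict_law (s : Strategy K) (x : Fin K → Fin d → ℝ) (σ : ℝ≥0) (θ : Fin d → ℝ)
    {i : ℕ} {B : Set (Traj K)} (hB : MeasurableSet[obsFiltration K i] B) :
    ((s.law x σ θ).restrict B).map (fun ω => ω i) =
      ((s.law x σ θ).restrict B).map (fun ω => (ω i).1) ⊗ₘ rewardKernel x σ θ := by
  have hB' : MeasurableSet B := (obsFiltration K).le i _ hB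
  -- The right-hand side sees `f` only through its mean over the reward, so `f` and that mean, as a
  -- function of the arm, have the same integral.
  have key : ∀ f : Obs K → ℝ≥0∞, Measurable f → ∫⁻ ω in B, f (ω i) ∂s.law x σ θ =
      ∫⁻ ω, B.indicator 1 ω * ∫⁻ a, ∫⁻ r, f (a, r) ∂rewardKernel x σ θ a ∂s.arm i ω
        ∂s.law x σ θ := by
    intro f hf
    have h1 : ∫⁻ ω in B, f (ω i) ∂s.law x σ θ =
        ∫⁻ ω, B.indicator 1 ω * f (ω i) ∂s.law x σ θ := by
      rw [← lintegral_indicator hB']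
      refine lintegral_congr fun ω => ?_
      by_cases hω : ω ∈ B <;> simp [hω]
    have hind : ∀ ω ω' : Traj K, (∀ j < i, ω j = ω' j) →
        B.indicator (1 : Traj K → ℝ≥0∞) ω = B.indicator 1 ω' := fun ω ω' h => by
      have := mem_iff_of_measurableSet_obsFiltration hB h
      by_cases hω : ω ∈ B
      · simp [hω, this.1 hω]
      · simp [hω, mt this.2 hω]
    have hind' : ∀ (ω : Traj K) o, B.indicator (1 : Traj K → ℝ≥0∞) (Function.update ω i o) =
        B.indicator 1 ω := fun ω o => hind _ _ fun j hj => Function.update_of_ne hj.ne _ _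
    rw [h1, s.lintegral_law x σ θ i (G := fun ω => B.indicator 1 ω * f (ω i))
      ((measurable_one.indicator hB').mul (hf.comp (measurable_pi_apply i)))
      fun ω ω' h => congrArg₂ (· * ·)
        (hind ω ω' fun j hj => h j (Set.mem_Iio.2 (hj.trans (Nat.lt_succ_self i))))
        (congrArg f (h i (Set.mem_Iio.2 (Nat.lt_succ_self i))))]
    refine lintegral_congr fun ω => ?_
    rw [← lintegral_const_mul _ (measurable_of_countable _)]
    refine lintegral_congr fun a => ?_
    have hfa : Measurable fun r : ℝ => f (a, r) := hf.comp measurable_prodMk_left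
    rw [← lintegral_const_mul _ hfa]
    refine lintegral_congr fun r => ?_
    rw [hind', Function.update_self]
  refine Measure.ext_of_lintegral _ fun f hf => ?_
  have hF : Measurable fun a => ∫⁻ r, f (a, r) ∂rewardKernel x σ θ a := measurable_of_countable _
  have hm : Measurable fun ω : Traj K => (ω i).1 := measurable_fst.comp (measurable_pi_apply i)
  rw [lintegral_map hf (measurable_pi_apply i), Measure.lintegral_compProd hf,
    lintegral_map hF hm, key f hf,
    key (fun o => ∫⁻ r, f (o.1, r) ∂rewardKernel x σ θ o.1) (hF.comp measurable_fst)]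
  simp

lemma llr_eq_mul_sub (x : Fin K → Fin d → ℝ) (σ : ℝ≥0) (θ θ' : Fin d → ℝ) (a : Fin K) (r : ℝ) :
    llr x σ θ θ' (a, r) = (x a ⬝ᵥ θ' - x a ⬝ᵥ θ) / σ ^ 2 * r -
      (x a ⬝ᵥ θ' - x a ⬝ᵥ θ) * (x a ⬝ᵥ θ + x a ⬝ᵥ θ') / (2 * σ ^ 2) := by
  unfold llr
  ring

lemma integrable_llr_rewardKernel (x : Fin K → Fin d → ℝ) (σ : ℝ≥0) (θ θ' : Fin d → ℝ)
    (a : Fin K) : Integrable (fun r => llr x σ θ θ' (a, r)) (rewardKernel x σ θ a) := by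
  have h : Integrable (fun r : ℝ => r) (rewardKernel x σ θ a) :=
    memLp_one_iff_integrable.1 (memLp_id_gaussianReal' 1 (by simp))
  simp_rw [llr_eq_mul_sub]
  exact (h.const_mul _).sub (integrable_const _)

/-- The mean of the log-likelihood ratio is minus the Kullback–Leibler divergence of two Gaussian
laws with the same variance. -/
lemma integral_llr_rewardKernel (x : Fin K → Fin d → ℝ) (σ : ℝ≥0) (θ θ' : Fin d → ℝ)
    (a : Fin K) : ∫ r, llr x σ θ θ' (a, r) ∂rewardKernel x σ θ a =
      -((x a ⬝ᵥ θ' - x a ⬝ᵥ θ) ^ 2 / (2 * σ ^ 2)) := by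
  have h : Integrable (fun r : ℝ => r) (rewardKernel x σ θ a) :=
    memLp_one_iff_integrable.1 (memLp_id_gaussianReal' 1 (by simp))
  have hm : ∫ r, r ∂rewardKernel x σ θ a = x a ⬝ᵥ θ := integral_id_gaussianReal
  simp_rw [llr_eq_mul_sub]
  rw [integral_sub (h.const_mul _) (integrable_const _), integral_const_mul, hm]
  simp only [integral_const, probReal_univ, smul_eq_mul, one_mul]
  ring

lemma integrable_llr_compProd (x : Fin K → Fin d → ℝ) (σ : ℝ≥0) (θ θ' : Fin d → ℝ)
    (ν : Measure (Fin K)) [IsFiniteMeasure ν] :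
    Integrable (llr x σ θ θ') (ν ⊗ₘ rewardKernel x σ θ) := by
  rw [Measure.integrable_compProd_iff (measurable_llr x σ θ θ').aestronglyMeasurable]
  exact ⟨Filter.Eventually.of_forall (integrable_llr_rewardKernel x σ θ θ'), Integrable.of_finite⟩

lemma integrableOn_llr (s : Strategy K) (x : Fin K → Fin d → ℝ) (σ : ℝ≥0) (θ θ' : Fin d → ℝ)
    {i : ℕ} {B : Set (Traj K)} (hB : MeasurableSet[obsFiltration K i] B) :
    IntegrableOn (fun ω => llr x σ θ θ' (ω i)) B (s.law x σ θ) := by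
  have h : Integrable (llr x σ θ θ') (((s.law x σ θ).restrict B).map (fun ω => ω i)) := by
    rw [map_restrict_law s x σ θ hB]
    exact integrable_llr_compProd x σ θ θ' _
  exact h.comp_measurable (measurable_pi_apply i)

lemma setIntegral_llr (s : Strategy K) (x : Fin K → Fin d → ℝ) (σ : ℝ≥0) (θ θ' : Fin d → ℝ)
    {i : ℕ} {B : Set (Traj K)} (hB : MeasurableSet[obsFiltration K i] B) :
    ∫ ω in B, llr x σ θ θ' (ω i) ∂s.law x σ θ =
      -∑ a, (s.law x σ θ).real (B ∩ {ω | (ω i).1 = a}) *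
        ((x a ⬝ᵥ θ' - x a ⬝ᵥ θ) ^ 2 / (2 * σ ^ 2)) := by
  have hl := measurable_llr x σ θ θ'
  rw [← integral_map (φ := fun ω : Traj K => ω i) (measurable_pi_apply i).aemeasurable
    hl.aestronglyMeasurable, map_restrict_law s x σ θ hB,
    Measure.integral_compProd (integrable_llr_compProd x σ θ θ' _),
    integral_fintype Integrable.of_finite, ← Finset.sum_neg_distrib]
  refine Finset.sum_congr rfl fun a _ => ?_
  have hm : Measurable fun ω : Traj K => (ω i).1 := measurable_fst.comp (measurable_pi_apply i)
  rw [integral_llr_rewardKernel, map_measureReal_apply hm (measurableSet_singleton a),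
    measureReal_restrict_apply (hm (measurableSet_singleton a)), Set.inter_comm, smul_eq_mul,
    mul_neg]
  rfl

/-- The log-likelihood ratio of `θ'` against `θ` of the first `n` observations among those made
before stopping. -/
noncomputable def stoppedLlr (s : Strategy K) (x : Fin K → Fin d → ℝ) (σ : ℝ≥0)
    (θ θ' : Fin d → ℝ) (n : ℕ) (ω : Traj K) : ℝ :=
  ∑ i ∈ Finset.range n, {ω | (i : WithTop ℕ) < s.τ ω}.indicator (fun ω => llr x σ θ θ' (ω i)) ω

lemma Strategy.measurableSet_le (s : Strategy K) (n : ℕ) :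
    MeasurableSet[obsFiltration K n] {ω | s.τ ω ≤ n} :=
  s.isStoppingTime_τ n

lemma Strategy.measurableSet_gt (s : Strategy K) (n : ℕ) :
    MeasurableSet[obsFiltration K n] {ω | (n : WithTop ℕ) < s.τ ω} := by
  have : {ω | (n : WithTop ℕ) < s.τ ω} = {ω | s.τ ω ≤ n}ᶜ := by
    ext ω; simp
  rw [this]
  exact (s.measurableSet_le n).compl

lemma measurable_stoppedLlr (s : Strategy K) (x : Fin K → Fin d → ℝ) (σ : ℝ≥0)
    (θ θ' : Fin d → ℝ) (n : ℕ) : Measurable (stoppedLlr s x σ θ θ' n) := by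
  unfold stoppedLlr
  exact Finset.measurable_sum _ fun i _ => ((measurable_llr x σ θ θ').comp
    (measurable_pi_apply i)).indicator ((obsFiltration K).le i _ (s.measurableSet_gt i))

lemma integrable_stoppedLlr (s : Strategy K) (x : Fin K → Fin d → ℝ) (σ : ℝ≥0)
    (θ θ' : Fin d → ℝ) (n : ℕ) : Integrable (stoppedLlr s x σ θ θ' n) (s.law x σ θ) := by
  unfold stoppedLlr
  exact integrable_finsetSum _ fun i _ => (integrable_indicator_iff
    ((obsFiltration K).le i _ (s.measurableSet_gt i))).2
      (integrableOn_llr s x σ θ θ' (s.measurableSet_gt i))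

lemma integral_stoppedLlr (s : Strategy K) (x : Fin K → Fin d → ℝ) (σ : ℝ≥0)
    (θ θ' : Fin d → ℝ) (n : ℕ) : ∫ ω, stoppedLlr s x σ θ θ' n ω ∂s.law x σ θ =
      -∑ a, (∑ i ∈ Finset.range n,
          (s.law x σ θ).real ({ω | (i : WithTop ℕ) < s.τ ω} ∩ {ω | (ω i).1 = a})) *
        ((x a ⬝ᵥ θ' - x a ⬝ᵥ θ) ^ 2 / (2 * σ ^ 2)) := by
  unfold stoppedLlr
  rw [integral_finsetSum _ fun i _ => (integrable_indicator_iff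
    ((obsFiltration K).le i _ (s.measurableSet_gt i))).2
      (integrableOn_llr s x σ θ θ' (s.measurableSet_gt i))]
  simp_rw [Finset.sum_mul]
  rw [Finset.sum_comm, ← Finset.sum_neg_distrib]
  refine Finset.sum_congr rfl fun i _ => ?_
  rw [integral_indicator ((obsFiltration K).le i _ (s.measurableSet_gt i)),
    setIntegral_llr s x σ θ θ' (s.measurableSet_gt i)]

lemma ofReal_exp_stoppedLlr (s : Strategy K) (x : Fin K → Fin d → ℝ) (σ : ℝ≥0)
    (θ θ' : Fin d → ℝ) (n : ℕ) {ω : Traj K} (h : ∀ i : ℕ, i < n → (i : WithTop ℕ) < s.τ ω) :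
    ENNReal.ofReal (Real.exp (stoppedLlr s x σ θ θ' n ω)) = lik x σ θ θ' n ω := by
  unfold stoppedLlr lik
  rw [Finset.sum_congr rfl fun i hi => Set.indicator_of_mem
    (s := {ω | ((i : ℕ) : WithTop ℕ) < s.τ ω}) (h i (Finset.mem_range.1 hi)) _]

lemma setLIntegral_exp_stoppedLlr_gt (s : Strategy K) (x : Fin K → Fin d → ℝ) {σ : ℝ≥0}
    (hσ : σ ≠ 0) (θ θ' : Fin d → ℝ) (n : ℕ) :
    ∫⁻ ω in {ω | (n : WithTop ℕ) < s.τ ω},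
      ENNReal.ofReal (Real.exp (stoppedLlr s x σ θ θ' n ω)) ∂s.law x σ θ =
      s.law x σ θ' {ω | (n : WithTop ℕ) < s.τ ω} := by
  rw [law_eq_lintegral_lik s x hσ θ θ' (s.measurableSet_gt n)]
  refine setLIntegral_congr_fun ((obsFiltration K).le n _ (s.measurableSet_gt n)) fun ω hω => ?_
  exact ofReal_exp_stoppedLlr s x σ θ θ' n fun i hi =>
    lt_trans (WithTop.coe_lt_coe.2 hi) hω

/-- Change of measure at the stopping time. The sum up to `n` is the log-likelihood ratio of the
first `τ` observations here, and each event `τ = k` concerns only the first `k` observations. -/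
lemma setLIntegral_exp_stoppedLlr_le (s : Strategy K) (x : Fin K → Fin d → ℝ) {σ : ℝ≥0}
    (hσ : σ ≠ 0) (θ θ' : Fin d → ℝ) (n : ℕ) :
    ∫⁻ ω in {ω | s.τ ω ≤ n},
      ENNReal.ofReal (Real.exp (stoppedLlr s x σ θ θ' n ω)) ∂s.law x σ θ =
      s.law x σ θ' {ω | s.τ ω ≤ n} := by
  induction n with
  | zero =>
    rw [law_eq_lintegral_lik s x hσ θ θ' (s.measurableSet_le 0)]
    simp [stoppedLlr, lik]
  | succ n ih =>
    have hn := (obsFiltration K).le n _ (s.measurableSet_le n)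
    have hmono : {ω | s.τ ω ≤ (n : ℕ)} ⊆ {ω | s.τ ω ≤ (n + 1 : ℕ)} := fun ω hω =>
      le_trans (show s.τ ω ≤ (n : ℕ) from hω) (WithTop.coe_le_coe.2 (Nat.le_succ n))
    have hdm : MeasurableSet[obsFiltration K (n + 1)]
        ({ω | s.τ ω ≤ (n + 1 : ℕ)} \ {ω | s.τ ω ≤ (n : ℕ)}) :=
      (s.measurableSet_le (n + 1)).diff
        ((obsFiltration K).mono (Nat.le_succ n) _ (s.measurableSet_le n))
    have hdm' := (obsFiltration K).le _ _ hdm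
    have hu : {ω | s.τ ω ≤ (n + 1 : ℕ)} =
        {ω | s.τ ω ≤ (n : ℕ)} ∪ ({ω | s.τ ω ≤ (n + 1 : ℕ)} \ {ω | s.τ ω ≤ (n : ℕ)}) :=
      (Set.union_sdiff_cancel hmono).symm
    rw [hu, lintegral_union hdm' Set.disjoint_sdiff_right,
      measure_union Set.disjoint_sdiff_right hdm', ← ih,
      law_eq_lintegral_lik s x hσ θ θ' hdm]
    congr 1
    · refine setLIntegral_congr_fun hn fun ω hω => ?_
      have hω' : ω ∉ {ω | (n : WithTop ℕ) < s.τ ω} := fun h =>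
        (not_le.2 h : ¬ s.τ ω ≤ n) hω
      simp only [stoppedLlr]
      rw [Finset.sum_range_succ, Set.indicator_of_notMem hω', add_zero]
    · refine setLIntegral_congr_fun hdm' fun ω hω => ?_
      have h1 : (n : WithTop ℕ) < s.τ ω := not_le.1 hω.2
      exact ofReal_exp_stoppedLlr s x σ θ θ' (n + 1) fun i hi =>
        lt_of_le_of_lt (WithTop.coe_le_coe.2 (Nat.lt_succ_iff.1 hi)) h1

/-- A substitute for Jensen's inequality: the tangent of the logarithm at `exp c` lies above it. -/
lemma setIntegral_le_of_lintegral_exp_le {Ω : Type*} [MeasurableSpace Ω] {μ : Measure Ω}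
    [IsFiniteMeasure μ] {Z : Ω → ℝ} (hZm : Measurable Z) (hZ : Integrable Z μ) (B : Set Ω) {q : ℝ}
    (hq : 0 ≤ q) (h : ∫⁻ ω in B, ENNReal.ofReal (Real.exp (Z ω)) ∂μ ≤ ENNReal.ofReal q) (c : ℝ) :
    ∫ ω in B, Z ω ∂μ ≤ Real.exp (-c) * q + (c - 1) * μ.real B := by
  have hmeas : Measurable fun ω => Real.exp (Z ω) := by fun_prop
  have hint : IntegrableOn (fun ω => Real.exp (Z ω)) B μ :=
    ⟨hmeas.aestronglyMeasurable, by
      rw [hasFiniteIntegral_iff_ofReal (Filter.Eventually.of_forall fun ω => (Real.exp_pos _).le)]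
      exact h.trans_lt ENNReal.ofReal_lt_top⟩
  have hval : ∫ ω in B, Real.exp (Z ω) ∂μ ≤ q := by
    rw [integral_eq_lintegral_of_nonneg_ae
      (Filter.Eventually.of_forall fun ω => (Real.exp_pos _).le) hmeas.aestronglyMeasurable]
    exact ENNReal.toReal_le_of_le_ofReal hq h
  calc ∫ ω in B, Z ω ∂μ ≤ ∫ ω in B, (Real.exp (-c) * Real.exp (Z ω) + (c - 1)) ∂μ := by
        refine integral_mono hZ.integrableOn ((hint.const_mul _).add (integrable_const _))
          fun ω => ?_
        have := Real.add_one_le_exp (-c + Z ω)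
        rw [Real.exp_add] at this
        simp only
        linarith
    _ = Real.exp (-c) * ∫ ω in B, Real.exp (Z ω) ∂μ + (c - 1) * μ.real B := by
        rw [integral_add (hint.const_mul _) (integrable_const _), integral_const_mul]
        simp [mul_comm]
    _ ≤ _ := by gcongr

/-- The expected number of pulls of arm `a` before stopping. -/
noncomputable def expectedPulls (s : Strategy K) (x : Fin K → Fin d → ℝ) (σ : ℝ≥0)
    (θ : Fin d → ℝ) (a : Fin K) : ℝ≥0∞ :=
  ∑' i : ℕ, s.law x σ θ ({ω | (i : WithTop ℕ) < s.τ ω} ∩ {ω | (ω i).1 = a})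

lemma toENNReal_eq_tsum (m : ℕ∞) :
    ENat.toENNReal m = ∑' i : ℕ, if (i : ℕ∞) < m then (1 : ℝ≥0∞) else 0 := by
  induction m using ENat.recTopCoe with
  | top => simp
  | coe m =>
    rw [tsum_eq_sum (s := Finset.range m) fun i hi => if_neg fun h =>
      hi (Finset.mem_range.2 (Nat.cast_lt.1 h)),
      Finset.sum_congr rfl fun i hi => if_pos (Nat.cast_lt.2 (Finset.mem_range.1 hi))]
    simp

lemma expectedTime_eq_tsum (s : Strategy K) (x : Fin K → Fin d → ℝ) (σ : ℝ≥0) (θ : Fin d → ℝ) :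
    s.expectedTime x σ θ = ∑' i : ℕ, s.law x σ θ {ω | (i : WithTop ℕ) < s.τ ω} := by
  have hm : ∀ i : ℕ, MeasurableSet {ω | (i : WithTop ℕ) < s.τ ω} := fun i =>
    (obsFiltration K).le i _ (s.measurableSet_gt i)
  have hτ : ∀ ω, ENat.toENNReal (s.τ ω) =
      ∑' i : ℕ, if (i : WithTop ℕ) < s.τ ω then (1 : ℝ≥0∞) else 0 := fun ω =>
    toENNReal_eq_tsum (s.τ ω)
  unfold Strategy.expectedTime
  simp_rw [hτ]
  have h : ∀ i : ℕ, (fun ω => if (i : WithTop ℕ) < s.τ ω then (1 : ℝ≥0∞) else 0) =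
      {ω | (i : WithTop ℕ) < s.τ ω}.indicator 1 := fun i => by
    ext ω; simp [Set.indicator_apply]
  rw [lintegral_tsum fun i => by rw [h i]; exact (measurable_one.indicator (hm i)).aemeasurable]
  refine tsum_congr fun i => ?_
  rw [h i, lintegral_indicator_one (hm i)]

lemma sum_expectedPulls (s : Strategy K) (x : Fin K → Fin d → ℝ) (σ : ℝ≥0) (θ : Fin d → ℝ) :
    ∑ a, expectedPulls s x σ θ a = s.expectedTime x σ θ := by
  unfold expectedPulls
  rw [expectedTime_eq_tsum, ← Summable.tsum_finsetSum fun _ _ => ENNReal.summable]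
  refine tsum_congr fun i => ?_
  have hm : Measurable fun ω : Traj K => (ω i).1 := measurable_fst.comp (measurable_pi_apply i)
  have hB : MeasurableSet {ω | (i : WithTop ℕ) < s.τ ω} :=
    (obsFiltration K).le i _ (s.measurableSet_gt i)
  have hdisj : Set.PairwiseDisjoint (↑(Finset.univ : Finset (Fin K)))
      fun a => {ω | (i : WithTop ℕ) < s.τ ω} ∩ {ω : Traj K | (ω i).1 = a} :=
    fun a _ b _ hab => Set.disjoint_left.2 fun ω h1 h2 => hab (h1.2.symm.trans h2.2)
  rw [← measure_biUnion_finset hdisj fun a _ => hB.inter (hm (measurableSet_singleton a))]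
  congr 1
  ext ω
  simp

lemma expectedPulls_ne_top (s : Strategy K) (x : Fin K → Fin d → ℝ) (σ : ℝ≥0) {θ : Fin d → ℝ}
    (hfin : s.expectedTime x σ θ ≠ ∞) (a : Fin K) : expectedPulls s x σ θ a ≠ ∞ := by
  refine ne_top_of_le_ne_top hfin ?_
  rw [← sum_expectedPulls]
  exact Finset.single_le_sum (fun _ _ => zero_le) (Finset.mem_univ a)

/-- If under `θ'` the strategy stops with probability at most `p`, while its expected stopping time
under `θ` is finite, then the expected log-likelihood ratio of `θ` against `θ'` at the stopping time
is at least `log (1 / p)`. -/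
lemma neg_log_le_sum_expectedPulls (s : Strategy K) (x : Fin K → Fin d → ℝ) {σ : ℝ≥0}
    (hσ : σ ≠ 0) (θ θ' : Fin d → ℝ) {p : ℝ} (hp : 0 < p)
    (hθ' : ∀ n : ℕ, s.law x σ θ' {ω | s.τ ω ≤ n} ≤ ENNReal.ofReal p)
    (hfin : s.expectedTime x σ θ ≠ ∞) :
    -Real.log p ≤ ∑ a, (expectedPulls s x σ θ a).toReal *
      ((x a ⬝ᵥ θ' - x a ⬝ᵥ θ) ^ 2 / (2 * σ ^ 2)) := by
  set C := ∑ a, (expectedPulls s x σ θ a).toReal *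
      ((x a ⬝ᵥ θ' - x a ⬝ᵥ θ) ^ 2 / (2 * σ ^ 2)) with hC
  set ε : ℕ → ℝ := fun n => (s.law x σ θ).real {ω | (n : WithTop ℕ) < s.τ ω} with hε
  have hε0 : Filter.Tendsto ε Filter.atTop (nhds 0) := by
    rw [expectedTime_eq_tsum] at hfin
    have := (ENNReal.tendsto_toReal ENNReal.zero_ne_top).comp
      (ENNReal.tendsto_atTop_zero_of_tsum_ne_top hfin)
    simpa [Function.comp_def, Measure.real, hε] using this
  have hlow : ∀ n, -C ≤ ∫ ω, stoppedLlr s x σ θ θ' n ω ∂s.law x σ θ := by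
    intro n
    rw [integral_stoppedLlr, hC]
    refine neg_le_neg (Finset.sum_le_sum fun a _ => mul_le_mul_of_nonneg_right ?_ (by positivity))
    simp only [Measure.real]
    rw [← ENNReal.toReal_sum fun _ _ => measure_ne_top _ _]
    exact ENNReal.toReal_mono (expectedPulls_ne_top s x σ hfin a) (ENNReal.sum_le_tsum _)
  have hcompl : ∀ n : ℕ, {ω | s.τ ω ≤ n}ᶜ = {ω | (n : WithTop ℕ) < s.τ ω} := fun n => by
    ext ω; simp
  -- The tangent at `log p` is used where `τ ≤ n`, the one at a free `k` where `n < τ`.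
  have hup : ∀ (k : ℝ) (n : ℕ), -C ≤ 1 + (Real.log p - 1) * (1 - ε n) +
      (Real.exp (-k) + (k - 1) * ε n) := by
    intro k n
    have hm := (obsFiltration K).le n _ (s.measurableSet_le n)
    refine (hlow n).trans ?_
    rw [← integral_add_compl hm (integrable_stoppedLlr s x σ θ θ' n), hcompl]
    have h1 := setIntegral_le_of_lintegral_exp_le (measurable_stoppedLlr s x σ θ θ' n)
      (integrable_stoppedLlr s x σ θ θ' n) {ω | s.τ ω ≤ n} hp.le
      ((setLIntegral_exp_stoppedLlr_le s x hσ θ θ' n).trans_le (hθ' n)) (Real.log p)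
    have h2 := setIntegral_le_of_lintegral_exp_le (measurable_stoppedLlr s x σ θ θ' n)
      (integrable_stoppedLlr s x σ θ θ' n) {ω | (n : WithTop ℕ) < s.τ ω} zero_le_one
      ((setLIntegral_exp_stoppedLlr_gt s x hσ θ θ' n).trans_le (by simpa using prob_le_one)) k
    have h3 : (s.law x σ θ).real {ω | s.τ ω ≤ n} = 1 - ε n := by
      have := probReal_compl_eq_one_sub (μ := s.law x σ θ) hm
      rw [hcompl] at this
      simp only [hε, this]; ring
    rw [Real.exp_neg, Real.exp_log hp, inv_mul_cancel₀ hp.ne', h3] at h1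
    rw [mul_one] at h2
    exact add_le_add h1 h2
  -- First `n → ∞` removes the event `n < τ`, then `k → ∞` removes the error `exp (-k)`.
  have hk : ∀ k : ℝ, -C ≤ Real.log p + Real.exp (-k) := by
    intro k
    refine ge_of_tendsto' (f := fun n => 1 + (Real.log p - 1) * (1 - ε n) +
      (Real.exp (-k) + (k - 1) * ε n)) (x := Filter.atTop) ?_ (hup k)
    have := ((hε0.const_sub 1).const_mul (Real.log p - 1)).const_add 1 |>.add
      ((hε0.const_mul (k - 1)).const_add (Real.exp (-k)))
    convert this using 2
    ring
  have : -C ≤ Real.log p := by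
    refine ge_of_tendsto' (f := fun k : ℝ => Real.log p + Real.exp (-k)) (x := Filter.atTop) ?_ hk
    simpa using (Real.tendsto_exp_neg_atTop_nhds_zero).const_add (Real.log p)
  linarith

/-! ### From the information inequality to the complexity -/

lemma designMatrix_mulVec (x : Fin K → Fin d → ℝ) (l : Fin K → ℝ) (v : Fin d → ℝ) :
    designMatrix x l *ᵥ v = ∑ b, (l b * (x b ⬝ᵥ v)) • x b := by
  simp only [designMatrix, Matrix.sum_mulVec, Matrix.smul_mulVec, Matrix.vecMulVec_mulVec,
    op_smul_eq_smul, smul_smul]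

lemma dotProduct_designMatrix_mulVec (x : Fin K → Fin d → ℝ) (l : Fin K → ℝ) (v : Fin d → ℝ) :
    v ⬝ᵥ designMatrix x l *ᵥ v = ∑ b, l b * (x b ⬝ᵥ v) ^ 2 := by
  simp only [designMatrix_mulVec, dotProduct_sum, dotProduct_smul, smul_eq_mul]
  exact Finset.sum_congr rfl fun b _ => by rw [dotProduct_comm v]; ring

lemma designMatrix_isHermitian (x : Fin K → Fin d → ℝ) (l : Fin K → ℝ) :
    (designMatrix x l).IsHermitian := by
  ext i j
  simp [designMatrix, Matrix.sum_apply, Matrix.vecMulVec_apply, mul_comm]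

lemma exists_dotProduct_ne_zero_of_span_eq_top {x : Fin K → Fin d → ℝ}
    (hx : Submodule.span ℝ (Set.range x) = ⊤) {v : Fin d → ℝ} (hv : v ≠ 0) :
    ∃ a, x a ⬝ᵥ v ≠ 0 := by
  by_contra! h
  refine hv (dotProduct_self_eq_zero.1 ?_)
  have hmem : v ∈ Submodule.span ℝ (Set.range x) := hx ▸ Submodule.mem_top
  refine Submodule.span_induction (p := fun u _ => u ⬝ᵥ v = 0) ?_ (by simp) ?_ ?_ hmem
  · rintro _ ⟨a, rfl⟩; exact h a
  · intro u w _ _ hu hw; rw [add_dotProduct, hu, hw, add_zero]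
  · intro c u _ hu; rw [smul_dotProduct, hu, smul_zero]

/-- If the allocation `w` separates `θ`, with information at least `2β`, from every parameter for
which some nonzero arm is at the threshold, then the total of `w` is at least `β` times the
complexity: the proportions `w / ∑ w` are an admissible design. -/
lemma ofReal_mul_complexity_le [Nonempty (Fin K)] {x : Fin K → Fin d → ℝ}
    (hx : Submodule.span ℝ (Set.range x) = ⊤) {ρ : ℝ} {θ : Fin d → ℝ} {w : Fin K → ℝ}
    (hw : ∀ a, 0 ≤ w a) {β : ℝ} (hβ : 0 < β)
    (h : ∀ a θ', x a ≠ 0 → x a ⬝ᵥ θ' = ρ → 2 * β ≤ ∑ b, w b * (x b ⬝ᵥ θ' - x b ⬝ᵥ θ) ^ 2) :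
    ENNReal.ofReal β * complexity x ρ θ ≤ ENNReal.ofReal (∑ a, w a) := by
  -- It is enough to bound the maximum over the arms for a single design.
  suffices H : ∃ l ∈ stdSimplex ℝ (Fin K), (designMatrix x l).PosDef ∧
      ∀ a, 2 * (x a ⬝ᵥ ((designMatrix x l)⁻¹ *ᵥ x a)) ≤ (∑ a, w a) / β * gap x ρ θ a ^ 2 by
    obtain ⟨l, hl, hpos, ha⟩ := H
    have hT : 0 ≤ (∑ a, w a) / β := div_nonneg (Finset.sum_nonneg fun a _ => hw a) hβ.le
    have hc : complexity x ρ θ ≤ ENNReal.ofReal ((∑ a, w a) / β) := by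
      refine (iInf₂_le l ⟨hl, hpos⟩).trans (iSup_le fun a => ENNReal.div_le_of_le_mul ?_)
      rw [← ENNReal.ofReal_mul hT]
      exact ENNReal.ofReal_le_ofReal (ha a)
    calc ENNReal.ofReal β * complexity x ρ θ
        ≤ ENNReal.ofReal β * ENNReal.ofReal ((∑ a, w a) / β) := by gcongr
      _ = ENNReal.ofReal (∑ a, w a) := by
        rw [← ENNReal.ofReal_mul hβ.le, mul_div_cancel₀ _ hβ.ne']
  by_cases h0 : ∀ a, x a = 0
  -- If all arms vanish then `d = 0`, and every design has an invertible (empty) matrix.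
  · obtain ⟨a₀⟩ := ‹Nonempty (Fin K)›
    refine ⟨Pi.single a₀ 1, single_mem_stdSimplex ℝ a₀, ?_, fun a => ?_⟩
    · refine Matrix.PosDef.of_dotProduct_mulVec_pos (designMatrix_isHermitian x _) fun v hv => ?_
      obtain ⟨a, ha⟩ := exists_dotProduct_ne_zero_of_span_eq_top hx hv
      simp [h0 a] at ha
    · rw [h0 a, zero_dotProduct, mul_zero]
      exact mul_nonneg (div_nonneg (Finset.sum_nonneg fun a _ => hw a) hβ.le) (sq_nonneg _)
  push Not at h0
  obtain ⟨a₀, ha₀⟩ := h0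
  -- A direction that moves the mean of a nonzero arm carries information.
  have hdir : ∀ (a : Fin K) (v : Fin d → ℝ), x a ⬝ᵥ v ≠ 0 →
      2 * β * (x a ⬝ᵥ v) ^ 2 ≤ (ρ - x a ⬝ᵥ θ) ^ 2 * ∑ b, w b * (x b ⬝ᵥ v) ^ 2 := by
    intro a v hav
    have hxa : x a ≠ 0 := fun h => hav (by simp [h])
    have := h a (θ + ((ρ - x a ⬝ᵥ θ) / (x a ⬝ᵥ v)) • v) hxa (by
      rw [dotProduct_add, dotProduct_smul, smul_eq_mul, div_mul_cancel₀ _ hav]; ring)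
    simp only [dotProduct_add, dotProduct_smul, smul_eq_mul, add_sub_cancel_left, mul_pow,
      div_pow] at this
    have hsum : ∑ b, w b * ((ρ - x a ⬝ᵥ θ) ^ 2 / (x a ⬝ᵥ v) ^ 2 * (x b ⬝ᵥ v) ^ 2) =
        (ρ - x a ⬝ᵥ θ) ^ 2 * (∑ b, w b * (x b ⬝ᵥ v) ^ 2) / (x a ⬝ᵥ v) ^ 2 := by
      rw [Finset.mul_sum, Finset.sum_div]
      exact Finset.sum_congr rfl fun b _ => by ring
    rw [hsum, le_div_iff₀ (by positivity)] at this
    exact this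
  have hquad : ∀ v : Fin d → ℝ, v ≠ 0 → 0 < ∑ b, w b * (x b ⬝ᵥ v) ^ 2 := by
    intro v hv
    obtain ⟨a, ha⟩ := exists_dotProduct_ne_zero_of_span_eq_top hx hv
    have h1 := hdir a v ha
    have h2 : 0 < 2 * β * (x a ⬝ᵥ v) ^ 2 := by positivity
    exact pos_of_mul_pos_right (h2.trans_le h1) (sq_nonneg _)
  have hTpos : 0 < ∑ a, w a := by
    refine lt_of_le_of_ne (Finset.sum_nonneg fun a _ => hw a) fun hT => ?_
    have hw0 := (Finset.sum_eq_zero_iff_of_nonneg fun a _ => hw a).1 hT.symm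
    have := hquad (x a₀) ha₀
    rw [Finset.sum_eq_zero fun b hb => by rw [hw0 b hb, zero_mul]] at this
    exact this.false
  set T := ∑ a, w a with hT
  have hscale : ∀ v : Fin d → ℝ,
      v ⬝ᵥ designMatrix x (fun b => w b / T) *ᵥ v = (∑ b, w b * (x b ⬝ᵥ v) ^ 2) / T := by
    intro v
    rw [dotProduct_designMatrix_mulVec, Finset.sum_div]
    exact Finset.sum_congr rfl fun b _ => by ring
  have hpos : (designMatrix x fun b => w b / T).PosDef := by
    refine Matrix.PosDef.of_dotProduct_mulVec_pos (designMatrix_isHermitian x _) fun v hv => ?_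
    rw [star_trivial, hscale]
    exact div_pos (hquad v hv) hTpos
  refine ⟨fun b => w b / T, ⟨fun b => div_nonneg (hw b) hTpos.le, ?_⟩, hpos, fun a => ?_⟩
  · rw [← Finset.sum_div, ← hT, div_self hTpos.ne']
  -- The direction `A⁻¹ x_a` is the one in which the mean of arm `a` moves at the least cost.
  set A := designMatrix x fun b => w b / T with hA
  set v := A⁻¹ *ᵥ x a with hv
  have hAv : A *ᵥ v = x a := by
    rw [hv, Matrix.mulVec_mulVec, Matrix.mul_nonsing_inv _ hpos.det_pos.ne'.isUnit,
      Matrix.one_mulVec]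
  have hq : (∑ b, w b * (x b ⬝ᵥ v) ^ 2) = T * (x a ⬝ᵥ v) := by
    have := hscale v
    rw [hAv, eq_div_iff hTpos.ne'] at this
    rw [← this, dotProduct_comm v, mul_comm]
  rw [gap, sq_abs]
  rcases eq_or_ne (x a ⬝ᵥ v) 0 with h0 | h0
  · rw [h0, mul_zero]; positivity
  · have h1 := hdir a v h0
    have hvpos : 0 < x a ⬝ᵥ v := by
      have : 0 < ∑ b, w b * (x b ⬝ᵥ v) ^ 2 := hquad v fun h => h0 (by simp [h])
      rw [hq] at this
      exact pos_of_mul_pos_right this hTpos.le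
    rw [hq] at h1
    rw [div_mul_eq_mul_div, le_div_iff₀ hβ]
    nlinarith [h1, hvpos]

end LinearTBP

/-- Lower bound on the expected sample complexity of every `δ`-correct strategy. -/
theorem mainTheorem2 {K d : ℕ} (x : Fin K → Fin d → ℝ)
    (hx : Submodule.span ℝ (Set.range x) = ⊤) (σ : ℝ≥0) (ρ δ : ℝ) (hδ : δ ∈ Set.Ioo (0 : ℝ) 1)
    (s : LinearTBP.Strategy K) (hs : s.IsCorrect x σ ρ δ) (θ : Fin d → ℝ) :
    ENNReal.ofReal (σ ^ 2 * Real.log (1 / (2 * δ))) * LinearTBP.complexity x ρ θ ≤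
      s.expectedTime x σ θ := by
  -- For `σ = 0` or `1 / 2 ≤ δ` the left-hand side vanishes.
  rcases le_or_gt (σ ^ 2 * Real.log (1 / (2 * δ))) 0 with hβ | hβ
  · rw [ENNReal.ofReal_of_nonpos hβ, zero_mul]
    exact zero_le
  by_cases hfin : s.expectedTime x σ θ = ∞
  · simp [hfin]
  have hσ : σ ≠ 0 := by rintro rfl; simp at hβ
  have hσ' : (0 : ℝ) < σ := by exact_mod_cast hσ.bot_lt
  have : Nonempty (Fin K) := nonempty_of_isProbabilityMeasure s.init
  have hsum := LinearTBP.sum_expectedPulls s x σ θ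
  have hT : ENNReal.ofReal (∑ a, (LinearTBP.expectedPulls s x σ θ a).toReal) =
      s.expectedTime x σ θ := by
    rw [← ENNReal.toReal_sum fun a _ => LinearTBP.expectedPulls_ne_top s x σ hfin a, hsum,
      ENNReal.ofReal_toReal hfin]
  rw [← hT]
  refine LinearTBP.ofReal_mul_complexity_le hx (fun a => ENNReal.toReal_nonneg) hβ
    fun a θ' ha hθ' => ?_
  have h := LinearTBP.neg_log_le_sum_expectedPulls s x hσ θ θ' (p := 2 * δ)
    (by linarith [hδ.1]) (LinearTBP.law_tau_le_of_at_threshold hσ hδ hs ha hθ') hfin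
  rw [one_div, Real.log_inv]
  simp only [← mul_div_assoc] at h
  rw [← Finset.sum_div, le_div_iff₀ (by positivity)] at h
  linarith
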